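/- Let $A$ be a C*-algebra (not necessarily unital), let $n$ be a positive integer, let $M_n$ be the C*-algebra of complex $n \times n$ matrices with its standard matrix units $(e_{j,k})_{j,k=1}^n$, and let $\varphi \colon M_n \to A$ be a linear map. Let $C M_n = C_0((0,1]) \otimes M_n = \{ f \in C([0,1], M_n) : f(0) = 0 \}$ be the cone over $M_n$, let $t \in C_0((0,1])$ be the function $t(\lambda) = \lambda$, and let $A^+$ be the unitization of $A$ (a new identity is added even if $A$ is already unital), with identity $1$. A linear map $\psi$ between C*-algebras has order zero if $\psi(a)\psi(b) = 0$ whenever $a, b \geq 0$ and $ab = 0$. Put $x_{j,k} = \varphi(e_{j,k})$ for $j, k = 1, \ldots, n$, and consider the following relations: (a) $x_{j,k} x_{k,m} = x_{j,l} x_{l,m}$ for $j, k, l, m = 1, \ldots, n$; (b) $x_{j,j} x_{k,k} = 0$ for $j, k = 1, \ldots, n$ with $j \neq k$; (c) $x_{j,k} = x_{k,j}^*$ for $j, k = 1, \ldots, n$; (d) $\| x_{j,j} \| \leq 1$ for $j = 1, \ldots, n$; (e) $\| 1 - x_{j,j} \| \leq 1$ for $j = 1, \ldots, n$; (f) $x_{j,j}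 \geq 0$ for $j = 1, \ldots, n$. Then the following are equivalent: (1) $\varphi$ is completely positive and contractive and has order zero. (2) There is a $*$-homomorphism $\pi \colon C M_n \to A$ such that $\varphi(z) = \pi(t \otimes z)$ for all $z \in M_n$. (3) The elements $x_{j,k}$ satisfy (a), (b), (c), (d) and (e) as elements of the C*-algebra $A^+$. (4) The elements $x_{j,k}$ satisfy (a), (b), (c), (d) and (f) as elements of the C*-algebra $A$. -/

import Mathlib

open scoped ComplexOrder CStarAlgebra

/-- The C*-algebra `M_n` of complex `n × n` matrices, with the operator norm
and the usual order. -/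
abbrev MatAlg (n : ℕ) : Type := CStarMatrix (Fin n) (Fin n) ℂ

/-- The standard matrix unit `e_{j,k}` of `M_n`. -/
def matUnit {n : ℕ} (j k : Fin n) : MatAlg n :=
  CStarMatrix.ofMatrix (Matrix.single j k (1 : ℂ))

/-- The cone `C B = {f ∈ C([0, 1], B) : f(0) = 0}` over a C*-algebra `B`, with pointwise operations
and the supremum norm. -/
def cone (B : Type*) [NonUnitalCStarAlgebra B] : NonUnitalStarSubalgebra ℂ C(unitInterval, B) where
  carrier := {f | f 0 = 0}
  add_mem' {f g} hf hg := by
    simp only [Set.mem_ofPred_eq] at hf hg ⊢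
    simp [hf, hg]
  zero_mem' := by simp
  mul_mem' {f g} hf hg := by
    simp only [Set.mem_ofPred_eq] at hf hg ⊢
    simp [hf]
  smul_mem' c f hf := by
    simp only [Set.mem_ofPred_eq] at hf ⊢
    simp [hf]
  star_mem' {f} hf := by
    simp only [Set.mem_ofPred_eq] at hf ⊢
    simp [hf]

/-- The element `t ⊗ b` of the cone `C B`, that is, the function `s ↦ s b` on `[0, 1]`. -/
def coneTensor {B : Type*} [NonUnitalCStarAlgebra B] (b : B) : cone B :=
  ⟨⟨fun s => ((s : ℝ) : ℂ) • b, by fun_prop⟩, by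
    change (((0 : unitInterval) : ℝ) : ℂ) • b = 0
    simp⟩

/-- Complete positivity of a linear map: it underlies a completely positive map. -/
def IsCP {A₁ A₂ : Type*} [NonUnitalCStarAlgebra A₁] [NonUnitalCStarAlgebra A₂]
    [PartialOrder A₁] [PartialOrder A₂] [StarOrderedRing A₁] [StarOrderedRing A₂]
    (φ : A₁ →ₗ[ℂ] A₂) : Prop :=
  ∃ ψ : A₁ →CP A₂, ψ.toLinearMap = φ

/-- A linear map has order zero if it sends orthogonal positive elements to orthogonal
elements. (For positive `a`, `b` the conditions `a b = 0` and `b a = 0` are equivalent, by taking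
adjoints; for a completely positive map the images of `a` and `b` are again positive.) -/
def IsOrderZero {A₁ A₂ : Type*} [NonUnitalCStarAlgebra A₁] [NonUnitalCStarAlgebra A₂]
    [PartialOrder A₁] (φ : A₁ →ₗ[ℂ] A₂) : Prop :=
  ∀ a b : A₁, 0 ≤ a → 0 ≤ b → a * b = 0 → φ a * φ b = 0

/-- The relations on a family `x_{j,k}` in a C*-algebra that do not involve
a unit or the order. -/
structure ConeRelations {n : ℕ} {B : Type*} [NonUnitalCStarAlgebra B]
    (x : Fin n → Fin n → B) : Prop where
  mul_eq : ∀ j k l m, x j k * x k m = x j l * x l m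
  orthogonal : ∀ j k, j ≠ k → x j j * x k k = 0
  adjoint : ∀ j k, x j k = star (x k j)
  norm_le : ∀ j, ‖x j j‖ ≤ 1

/- (1) ⇒ (4): by a `2 × 2` positivity argument a completely positive map of order zero preserves
all zero products, not only those of positive elements, and `(e_{j,k} + e_{j,l}) (e_{k,m} - e_{l,m})
= 0` then gives (a).

(4) ⇒ (2): the element `h = ∑ x_{j,j}` is a positive contraction that commutes with every `x_{j,k}`
and satisfies `x_{j,k} x_{k,m} = h x_{j,m}`, so `f ⊗ e_{j,k} ↦ (f / t)(h) x_{j,k}` is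
multiplicative. Because `x_{j,k} x_{j,k}* ≤ h²`, it is bounded by `‖f‖` on the dense ideal
`t C([0, 1])` of `C_0((0, 1])`, and hence extends to the cone.

(2) ⇒ (1): the factorization `t ⊗ a* b = (√t ⊗ a)* (√t ⊗ b)` makes `a ↦ π (t ⊗ a)` completely
positive. -/

-- `CStarAlgebra.nonneg_iff_eq_star_mul_self` does not elaborate directly for `CStarMatrix`: the
-- functional calculus over `ℝ` is found only for a generic `NonUnitalCStarAlgebra`.
lemma exists_eq_star_mul_self_of_nonneg {B : Type*} [NonUnitalCStarAlgebra B] [PartialOrder B]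
    [StarOrderedRing B] {b : B} (hb : 0 ≤ b) : ∃ c, b = star c * c :=
  CStarAlgebra.nonneg_iff_eq_star_mul_self.mp hb

section CompletePositivity
variable {A₁ A₂ : Type*} [NonUnitalCStarAlgebra A₁] [NonUnitalCStarAlgebra A₂]
  [PartialOrder A₁] [PartialOrder A₂] [StarOrderedRing A₁] [StarOrderedRing A₂]
  {φ : A₁ →ₗ[ℂ] A₂}

namespace IsCP

lemma map_nonneg (hφ : IsCP φ) {a : A₁} (ha : 0 ≤ a) : 0 ≤ φ a := by
  obtain ⟨ψ, rfl⟩ := hφ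
  exact _root_.map_nonneg ψ ha

lemma map_star (hφ : IsCP φ) (a : A₁) : φ (star a) = star (φ a) := by
  obtain ⟨ψ, rfl⟩ := hφ
  exact StarHomClass.map_star ψ a

lemma exists_map_star_mul_self_eq (hφ : IsCP φ) {k : ℕ} (N : CStarMatrix (Fin k) (Fin k) A₁) :
    ∃ Y : CStarMatrix (Fin k) (Fin k) A₂,
      ∀ i j, φ ((star N * N) i j) = ∑ l, star (Y l i) * Y l j := by
  obtain ⟨ψ, rfl⟩ := hφ
  obtain ⟨Y, hY⟩ := exists_eq_star_mul_self_of_nonneg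
    (ψ.map_cstarMatrix_nonneg (star N * N) (star_mul_self_nonneg N))
  refine ⟨Y, fun i j => (congrFun (congrFun hY i) j).trans ?_⟩
  simp only [CStarMatrix.mul_apply, CStarMatrix.star_apply]

-- Apply `φ` to the entries of `N* N`, where `N` has first row `(b, a)` and second row `0`.
lemma map_mul_mul_eq_zero (hφ : IsCP φ) {a : A₁} {s : A₂} (h : φ (star a * a) * s = 0) (b : A₁) :
    φ (b * a) * s = 0 := by
  obtain ⟨Y, hY⟩ := hφ.exists_map_star_mul_self_eq
    (CStarMatrix.ofMatrix !![star b, a; 0, 0])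
  have hba : φ (b * a) = ∑ l, star (Y l 0) * Y l 1 := by
    simpa [CStarMatrix.mul_apply, CStarMatrix.star_apply] using hY 0 1
  have haa : φ (star a * a) = ∑ l, star (Y l 1) * Y l 1 := by
    simpa [CStarMatrix.mul_apply, CStarMatrix.star_apply] using hY 1 1
  have hsum : ∑ l, star (Y l 1 * s) * (Y l 1 * s) = 0 := calc
    _ = star s * (φ (star a * a) * s) := by
      simp only [haa, Finset.sum_mul, Finset.mul_sum, star_mul, mul_assoc]
    _ = 0 := by rw [h, mul_zero]
  have hYs (l : Fin 2) : Y l 1 * s = 0 :=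
    (CStarRing.star_mul_self_eq_zero_iff _).mp <|
      (Finset.sum_eq_zero_iff_of_nonneg fun l _ => star_mul_self_nonneg (Y l 1 * s)).mp hsum l
        (Finset.mem_univ l)
  simp only [hba, Finset.sum_mul, mul_assoc, hYs, mul_zero, Finset.sum_const_zero]

lemma of_map_star_mul (θ : A₁ → A₂) (hθ : ∀ a b, φ (star a * b) = star (θ a) * θ b) : IsCP φ := by
  refine ⟨⟨φ, fun k M hM => ?_⟩, rfl⟩
  obtain ⟨N, rfl⟩ := exists_eq_star_mul_self_of_nonneg hM
  have hN : (star N * N).map φ = star (N.map θ) * N.map θ := by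
    ext i j
    simp only [CStarMatrix.map_apply, CStarMatrix.mul_apply, CStarMatrix.star_apply, map_sum, hθ]
  exact hN ▸ star_mul_self_nonneg _

end IsCP

end CompletePositivity

lemma IsOrderZero.map_mul_map_eq_zero {A₁ A₂ : Type*} [CStarAlgebra A₁] [NonUnitalCStarAlgebra A₂]
    [PartialOrder A₁] [PartialOrder A₂] [StarOrderedRing A₁] [StarOrderedRing A₂]
    {φ : A₁ →ₗ[ℂ] A₂} (hφ : IsOrderZero φ) (hcp : IsCP φ) {a b : A₁} (hab : a * b = 0) :
    φ a * φ b = 0 := by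
  have of_nonneg {c d : A₁} (hd : 0 ≤ d) (hcd : c * d = 0) : φ c * φ d = 0 := by
    have := hφ _ _ (star_mul_self_nonneg c) hd (by rw [mul_assoc, hcd, mul_zero])
    simpa only [one_mul] using hcp.map_mul_mul_eq_zero this 1
  have hbb : φ (b * star b) * φ (star a) = 0 := by
    have := of_nonneg (mul_star_self_nonneg b) (c := a) (by rw [← mul_assoc, hab, zero_mul])
    simpa only [star_mul, star_star, ← hcp.map_star, star_zero] using congrArg star this
  have hba : φ (star b) * φ (star a) = 0 := by
    simpa only [one_mul] using
      hcp.map_mul_mul_eq_zero (a := star b) (by rwa [star_star]) 1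
  simpa only [star_mul, hcp.map_star, star_star, star_zero] using congrArg star hba

section MatUnit
variable {n : ℕ}

lemma matUnit_apply (j k l m : Fin n) :
    (matUnit j k : MatAlg n) l m = if j = l ∧ k = m then 1 else 0 :=
  Matrix.single_apply ..

lemma matUnit_mul_same (j k m : Fin n) : matUnit j k * matUnit k m = (matUnit j m : MatAlg n) :=
  congrArg CStarMatrix.ofMatrix
    ((Matrix.single_mul_single_same (1 : ℂ) j k m 1).trans (by rw [one_mul]))

lemma matUnit_mul_of_ne (j : Fin n) {k l : Fin n} (m : Fin n) (h : k ≠ l) :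
    matUnit j k * matUnit l m = (0 : MatAlg n) :=
  congrArg CStarMatrix.ofMatrix (Matrix.single_mul_single_of_ne (1 : ℂ) j k l h 1)

lemma star_matUnit (j k : Fin n) : star (matUnit j k) = (matUnit k j : MatAlg n) := by
  ext l m
  simp [CStarMatrix.star_apply, matUnit_apply, and_comm, apply_ite]

lemma isStarProjection_matUnit_self (j : Fin n) : IsStarProjection (matUnit j j : MatAlg n) :=
  ⟨matUnit_mul_same j j j, star_matUnit j j⟩

lemma matAlg_eq_sum_smul_matUnit (z : MatAlg n) : z = ∑ j, ∑ k, z j k • matUnit j k := by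
  conv_lhs => rw [Matrix.matrix_eq_sum_single z]
  refine Finset.sum_congr rfl fun j _ => Finset.sum_congr rfl fun k _ => ?_
  ext l m
  simp [matUnit_apply, Matrix.single_apply]

lemma map_matUnit_mul_map_matUnit {A : Type*} [NonUnitalNonAssocRing A] [Module ℂ A]
    {φ : MatAlg n →ₗ[ℂ] A} (hφ : ∀ {a b}, a * b = 0 → φ a * φ b = 0) (j k l m : Fin n) :
    φ (matUnit j k) * φ (matUnit k m) = φ (matUnit j l) * φ (matUnit l m) := by
  rcases eq_or_ne k l with rfl | hkl
  · rfl
  have h : φ (matUnit j k + matUnit j l) * φ (matUnit k m - matUnit l m) = 0 := hφ <| by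
    rw [add_mul, mul_sub, mul_sub, matUnit_mul_same, matUnit_mul_same, matUnit_mul_of_ne _ _ hkl,
      matUnit_mul_of_ne _ _ hkl.symm, sub_zero, zero_sub, add_neg_cancel]
  rwa [map_add, map_sub, add_mul, mul_sub, mul_sub, hφ (matUnit_mul_of_ne _ _ hkl),
    hφ (matUnit_mul_of_ne _ _ hkl.symm), sub_zero, zero_sub, ← sub_eq_add_neg, sub_eq_zero] at h

end MatUnit

lemma IsOrderZero.coneRelations {A : Type*} [NonUnitalCStarAlgebra A] [PartialOrder A]
    [StarOrderedRing A] {n : ℕ} {φ : MatAlg n →ₗ[ℂ] A} (hφ : IsOrderZero φ) (hcp : IsCP φ)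
    (hcontr : ∀ z, ‖φ z‖ ≤ ‖z‖) : ConeRelations fun j k => φ (matUnit j k) where
  mul_eq := map_matUnit_mul_map_matUnit (hφ.map_mul_map_eq_zero hcp)
  orthogonal _ _ hjk := hφ.map_mul_map_eq_zero hcp (matUnit_mul_of_ne _ _ hjk)
  adjoint j k := by rw [← hcp.map_star, star_matUnit]
  norm_le j := (hcontr _).trans (isStarProjection_matUnit_self j).norm_le

section Cone
variable {B : Type*} [NonUnitalCStarAlgebra B]

instance isClosed_cone : IsClosed (cone B : Set C(unitInterval, B)) :=
  isClosed_singleton.preimage (continuous_eval_const (0 : unitInterval))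

lemma cone_ext {f g : cone B} (h : ∀ s, f.1 s = g.1 s) : f = g :=
  Subtype.ext (ContinuousMap.ext h)

lemma norm_coneTensor_le (b : B) : ‖coneTensor b‖ ≤ ‖b‖ := by
  refine (ContinuousMap.norm_le _ (norm_nonneg b)).mpr fun s => ?_
  change ‖((s : ℝ) : ℂ) • b‖ ≤ ‖b‖
  rw [norm_smul, Complex.norm_real, Real.norm_of_nonneg s.2.1]
  exact mul_le_of_le_one_left (norm_nonneg b) s.2.2

lemma coneTensor_mul_coneTensor_eq_zero {a b : B} (h : a * b = 0) :
    coneTensor a * coneTensor b = 0 :=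
  cone_ext fun s => (smul_mul_smul_comm _ a _ b).trans (by rw [h, smul_zero]; rfl)

/-- The element `√t ⊗ b` of the cone over `B`, a square root of `t ⊗ b` in the sense of
`star_coneSqrtTensor_mul`. -/
noncomputable def coneSqrtTensor (b : B) : cone B :=
  ⟨⟨fun s => ((√(s : ℝ) : ℝ) : ℂ) • b, by fun_prop⟩, by
    change ((√((0 : unitInterval) : ℝ) : ℝ) : ℂ) • b = 0
    simp⟩

lemma star_coneSqrtTensor_mul (a b : B) :
    star (coneSqrtTensor a) * coneSqrtTensor b = coneTensor (star a * b) := by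
  refine cone_ext fun s => ?_
  change star (((√(s : ℝ) : ℝ) : ℂ) • a) * (((√(s : ℝ) : ℝ) : ℂ) • b) = ((s : ℝ) : ℂ) • _
  rw [star_smul, smul_mul_smul_comm, Complex.star_def, Complex.conj_ofReal, ← Complex.ofReal_mul,
    Real.mul_self_sqrt s.2.1]

variable {A : Type*} [NonUnitalCStarAlgebra A] {φ : B →ₗ[ℂ] A} {π : cone B →⋆ₙₐ[ℂ] A}

lemma isCP_of_coneHom [PartialOrder A] [StarOrderedRing A] [PartialOrder B] [StarOrderedRing B]
    (hπ : ∀ z, φ z = π (coneTensor z)) : IsCP φ :=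
  .of_map_star_mul (fun z => π (coneSqrtTensor z)) fun a b => by
    rw [hπ, ← star_coneSqrtTensor_mul, map_mul, map_star]

lemma norm_le_of_coneHom (hπ : ∀ z, φ z = π (coneTensor z)) (z : B) : ‖φ z‖ ≤ ‖z‖ :=
  hπ z ▸ (NonUnitalStarAlgHom.norm_apply_le π _).trans (norm_coneTensor_le z)

lemma isOrderZero_of_coneHom [PartialOrder B] (hπ : ∀ z, φ z = π (coneTensor z)) :
    IsOrderZero φ := fun a b _ _ hab => by
  rw [hπ, hπ, ← map_mul, coneTensor_mul_coneTensor_eq_zero hab, map_zero]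

end Cone

section StarMul
variable {B : Type*} [NonUnitalCStarAlgebra B] {a b : B}

lemma mul_eq_zero_of_mul_mul_star_eq_zero (h : a * (b * star b) = 0) : a * b = 0 :=
  (CStarRing.mul_star_self_eq_zero_iff _).mp <| by
    rw [star_mul, ← mul_assoc, mul_assoc a, h, zero_mul]

lemma mul_eq_zero_of_star_mul_mul_eq_zero (h : star a * a * b = 0) : a * b = 0 :=
  (CStarRing.star_mul_self_eq_zero_iff _).mp <| by
    rw [star_mul, mul_assoc, ← mul_assoc (star a), h, mul_zero]

lemma norm_mul_le_norm_mul [PartialOrder B] [StarOrderedRing B]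
    (h : a * star a ≤ b * star b) (c : B) : ‖c * a‖ ≤ ‖c * b‖ := by
  have mul_mul_star (d : B) : c * d * star (c * d) = c * (d * star d) * star c := by
    simp only [star_mul, mul_assoc]
  refine (sq_le_sq₀ (norm_nonneg _) (norm_nonneg _)).mp ?_
  rw [sq, sq, ← CStarRing.norm_self_mul_star, ← CStarRing.norm_self_mul_star]
  refine CStarAlgebra.norm_le_norm_of_nonneg_of_le (mul_star_self_nonneg _) ?_
  rw [mul_mul_star, mul_mul_star]
  exact star_right_conjugate_le_conjugate h c

end StarMul

lemma norm_one_sub_le_one_iff_nonneg {B : Type*} [CStarAlgebra B] [PartialOrder B]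
    [StarOrderedRing B] {b : B} (hb : IsSelfAdjoint b) (hb₁ : ‖b‖ ≤ 1) :
    ‖1 - b‖ ≤ 1 ↔ 0 ≤ b := by
  have h := SpectrumRestricts.nnreal_iff_nnnorm (t := 1) hb hb₁
  rw [NNReal.coe_one, map_one] at h
  rw [nonneg_iff_isSelfAdjoint_and_quasispectrumRestricts, and_iff_right hb]
  exact h.symm

namespace ConeRelations
variable {n : ℕ} {B : Type*} [NonUnitalCStarAlgebra B] {x : Fin n → Fin n → B}

lemma map_iff {C : Type*} [NonUnitalCStarAlgebra C] (ι : B →⋆ₙₐ[ℂ] C)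
    (hι : Function.Injective ι) : ConeRelations (fun j k => ι (x j k)) ↔ ConeRelations x := by
  have hnorm (j : Fin n) : ‖ι (x j j)‖ = ‖x j j‖ := NonUnitalStarAlgHom.norm_map ι hι _
  refine ⟨fun h => ⟨fun j k l m => hι ?_, fun j k hjk => hι ?_, fun j k => hι ?_,
    fun j => hnorm j ▸ h.norm_le j⟩, fun h => ⟨fun j k l m => ?_, fun j k hjk => ?_,
    fun j k => ?_, fun j => (hnorm j).trans_le (h.norm_le j)⟩⟩
  · simpa only [map_mul] using h.mul_eq j k l m
  · simpa only [map_mul, map_zero] using h.orthogonal j k hjk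
  · simpa only [map_star] using h.adjoint j k
  · rw [← map_mul, ← map_mul, h.mul_eq]
  · rw [← map_mul, h.orthogonal j k hjk, map_zero]
  · rw [← map_star, ← h.adjoint]

lemma star_eq (hx : ConeRelations x) (j k : Fin n) : star (x j k) = x k j := (hx.adjoint k j).symm

lemma mul_eq_zero (hx : ConeRelations x) (j : Fin n) {k l : Fin n} (m : Fin n) (hkl : k ≠ l) :
    x j k * x l m = 0 := by
  have hdiag : x k k * x l m = 0 := mul_eq_zero_of_mul_mul_star_eq_zero <| by
    rw [hx.star_eq, hx.mul_eq l m l l, ← mul_assoc, hx.orthogonal k l hkl, zero_mul]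
  refine mul_eq_zero_of_star_mul_mul_eq_zero ?_
  rw [hx.star_eq, hx.mul_eq k j k k, mul_assoc, hdiag, mul_zero]

lemma sum_mul (hx : ConeRelations x) (j k : Fin n) : (∑ l, x l l) * x j k = x j j * x j k := by
  rw [Finset.sum_mul]
  exact Finset.sum_eq_single j (fun l _ hl => hx.mul_eq_zero l k hl) (by simp)

lemma mul_sum (hx : ConeRelations x) (j k : Fin n) : x j k * ∑ l, x l l = x j k * x k k := by
  rw [Finset.mul_sum]
  exact Finset.sum_eq_single k (fun l _ hl => hx.mul_eq_zero j l hl.symm) (by simp)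

lemma commute_sum (hx : ConeRelations x) (j k : Fin n) : Commute (∑ l, x l l) (x j k) := by
  rw [Commute, SemiconjBy, hx.sum_mul, hx.mul_sum, hx.mul_eq]

lemma mul_eq_sum_mul (hx : ConeRelations x) (j k m : Fin n) :
    x j k * x k m = (∑ l, x l l) * x j m := by
  rw [hx.sum_mul, hx.mul_eq]

lemma mul_mul_mul_same (hx : ConeRelations x) (a : B) {b : B} {j k : Fin n} (m : Fin n)
    (hb : Commute b (x j k)) : a * x j k * (b * x k m) = a * b * (∑ l, x l l) * x j m := by
  rw [hb.symm.mul_mul_mul_comm, hx.mul_eq_sum_mul, mul_assoc (a * b)]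

lemma mul_mul_mul_of_ne (hx : ConeRelations x) (a : B) {b : B} {j k l : Fin n} (m : Fin n)
    (hkl : k ≠ l) (hb : Commute b (x j k)) : a * x j k * (b * x l m) = 0 := by
  rw [hb.symm.mul_mul_mul_comm, hx.mul_eq_zero j m hkl, mul_zero]

lemma norm_sum_le (hx : ConeRelations x) : ‖∑ l, x l l‖ ≤ 1 := by
  rw [← coe_nnnorm, IsSelfAdjoint.nnnorm_sum_eq_sup (f := fun l => x l l) Finset.univ
    (fun l _ => hx.star_eq l l) (fun j k h => hx.orthogonal j k h)]
  exact NNReal.coe_le_one.mpr (Finset.sup_le fun l _ => hx.norm_le l)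

lemma mul_star_le [PartialOrder B] [StarOrderedRing B] (hx : ConeRelations x) (j k : Fin n) :
    x j k * star (x j k) ≤ (∑ l, x l l) * star (∑ l, x l l) := calc
  x j k * star (x j k) = x j j * star (x j j) := by rw [hx.star_eq, hx.star_eq, hx.mul_eq]
  _ ≤ ∑ l, x l l * star (x l l) := Finset.single_le_sum (f := fun l => x l l * star (x l l))
    (fun l _ => mul_star_self_nonneg _) (Finset.mem_univ j)
  _ = (∑ l, x l l) * star (∑ l, x l l) := by
    simp only [star_sum, hx.star_eq, Finset.mul_sum, hx.sum_mul]

end ConeRelations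

/-- The inclusion `t` of the unit interval into `ℂ`. -/
def intervalCoord : C(unitInterval, ℂ) := ⟨fun s => ((s : ℝ) : ℂ), by fun_prop⟩

/-- Multiplication `g ↦ t g` of functions on the unit interval by the coordinate function, with
values in the cone `C ℂ = C_0((0, 1])`. -/
noncomputable def coordMul : C(unitInterval, ℂ) →ₗ[ℂ] cone ℂ where
  toFun g := ⟨intervalCoord * g, show ((0 : ℝ) : ℂ) * g 0 = 0 by simp⟩
  map_add' f g := Subtype.ext (mul_add _ f g)
  map_smul' c f := Subtype.ext (mul_smul_comm c _ f)

lemma coordMul_one : coordMul 1 = coneTensor 1 := rfl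

lemma coordMul_mul_coordMul (f g : C(unitInterval, ℂ)) :
    coordMul f * coordMul g = coordMul (f * intervalCoord * g) :=
  Subtype.ext (by change intervalCoord * f * (intervalCoord * g) = intervalCoord * _; ring)

lemma star_coordMul (f : C(unitInterval, ℂ)) : star (coordMul f) = coordMul (star f) :=
  cone_ext fun s => by
    change star (((s : ℝ) : ℂ) * f s) = ((s : ℝ) : ℂ) * star (f s)
    simp

-- A closed ideal of `C([0, 1])` is determined by its zero set, which is `{0}` for the ideal `(t)`.
lemma denseRange_coordMul : DenseRange coordMul := by
  refine Subtype.dense_iff.mpr fun f hf => ?_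
  have hf_closure : f ∈ (Ideal.span {intervalCoord}).closure := by
    rw [← ContinuousMap.idealOfSet_ofIdeal_eq_closure, ContinuousMap.mem_idealOfSet]
    intro s hs
    have hs0 : intervalCoord s = 0 :=
      ContinuousMap.notMem_setOfIdeal.mp hs (Ideal.mem_span_singleton_self _)
    have hs0 : s = 0 := Subtype.ext (Complex.ofReal_eq_zero.mp hs0)
    exact hs0 ▸ hf
  refine closure_mono (fun g hg => ?_) hf_closure
  obtain ⟨c, rfl⟩ := Ideal.mem_span_singleton'.mp hg
  exact ⟨coordMul c, ⟨c, rfl⟩, mul_comm _ _⟩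

lemma exists_intervalCalculus {B : Type*} [CStarAlgebra B] [PartialOrder B] [StarOrderedRing B]
    {h : B} (h0 : 0 ≤ h) (h1 : ‖h‖ ≤ 1) :
    ∃ Φ : C(unitInterval, ℂ) →⋆ₐ[ℂ] B, Φ intervalCoord = h ∧
      ∀ b, Commute h b → ∀ f, Commute (Φ f) b := by
  have hsa : IsSelfAdjoint h := .of_nonneg h0
  have hnonneg (z : spectrum ℂ h) : 0 ≤ (z : ℂ).re ∧ 0 = (z : ℂ).im :=
    Complex.nonneg_iff.mp (spectrum_nonneg_of_nonneg h0 z.2)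
  have hle (z : spectrum ℂ h) : (z : ℂ).re ≤ 1 := by
    rcases subsingleton_or_nontrivial B with _ | _
    · simpa [spectrum.of_subsingleton] using z.2
    · exact (Complex.re_le_norm _).trans ((spectrum.norm_le_norm_of_mem z.2).trans h1)
  let toInterval : C(spectrum ℂ h, unitInterval) :=
    ⟨fun z => ⟨(z : ℂ).re, (hnonneg z).1, hle z⟩, by fun_prop⟩
  refine ⟨(cfcHom hsa.isStarNormal).comp (ContinuousMap.compStarAlgHom' ℂ ℂ toInterval), ?_,
    fun b hb f => hsa.commute_cfcHom _ hb _⟩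
  refine (congrArg (cfcHom _) ?_).trans (cfcHom_id hsa.isStarNormal)
  ext z
  exact Complex.ext rfl (hnonneg z).2

-- `Ψ` is `f ↦ (f / t)(h) x`.
lemma exists_coneMap_of_mul_star_le {A : Type*} [NonUnitalCStarAlgebra A] [PartialOrder A]
    [StarOrderedRing A] {h x : A} (Φ : C(unitInterval, ℂ) →⋆ₐ[ℂ] A⁺¹) (hΦ : Φ intervalCoord = h)
    (hx : x * star x ≤ h * star h) :
    ∃ Ψ : cone ℂ →L[ℂ] A, ∀ g, (Ψ (coordMul g) : A⁺¹) = Φ g * x := by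
  let L : C(unitInterval, ℂ) →ₗ[ℂ] A :=
    Unitization.sndHom ℂ ℂ A ∘ₗ LinearMap.mulRight ℂ (x : A⁺¹) ∘ₗ Φ.toAlgHom.toLinearMap
  have hL (g) : (L g : A⁺¹) = Φ g * x := Unitization.ext (by simp) rfl
  have hx' : (x : A⁺¹) * star (x : A⁺¹) ≤ h * star (h : A⁺¹) := by
    rw [← Unitization.inr_star, ← Unitization.inr_star, ← Unitization.inr_mul,
      ← Unitization.inr_mul]
    exact OrderHomClass.mono (Unitization.inrNonUnitalStarAlgHom ℂ A) hx
  have hbound (g) : ‖L g‖ ≤ 1 * ‖coordMul g‖ := calc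
    ‖L g‖ = ‖Φ g * x‖ := by rw [← hL, Unitization.norm_inr]
    _ ≤ ‖Φ g * h‖ := norm_mul_le_norm_mul hx' _
    _ = ‖Φ (intervalCoord * g)‖ := by rw [← hΦ, ← map_mul, mul_comm]
    _ ≤ ‖intervalCoord * g‖ := NonUnitalStarAlgHom.norm_apply_le Φ _
    _ = 1 * ‖coordMul g‖ := (one_mul _).symm
  exact ⟨L.extendOfNorm coordMul, fun g => by
    rw [LinearMap.extendOfNorm_eq denseRange_coordMul ⟨1, hbound⟩, hL]⟩

section Entry
variable {ι : Type*} [Fintype ι]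

/-- The `(j, k)` entry of an element of the cone over the `ι × ι` matrices, as an element of the
cone over `ℂ`. -/
noncomputable def coneEntry (j k : ι) : cone (CStarMatrix ι ι ℂ) →ₗ[ℂ] cone ℂ where
  toFun F := ⟨⟨fun s => F.1 s j k, by
      have : Continuous fun M : CStarMatrix ι ι ℂ => M j k := continuous_apply_apply j k
      exact this.comp F.1.continuous⟩, congrFun (congrFun F.2 j) k⟩
  map_add' _ _ := rfl
  map_smul' _ _ := rfl

lemma coneEntry_mul (F G : cone (CStarMatrix ι ι ℂ)) (j m : ι) :
    coneEntry j m (F * G) = ∑ k, coneEntry j k F * coneEntry k m G := by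
  refine cone_ext fun s => ?_
  rw [AddSubmonoidClass.coe_finsetSum, ContinuousMap.sum_apply]
  exact CStarMatrix.mul_apply

lemma coneEntry_star (F : cone (CStarMatrix ι ι ℂ)) (j k : ι) :
    coneEntry j k (star F) = star (coneEntry k j F) := rfl

lemma coneEntry_coneTensor (z : CStarMatrix ι ι ℂ) (j k : ι) :
    coneEntry j k (coneTensor z) = z j k • coneTensor (1 : ℂ) :=
  cone_ext fun s => by
    change ((s : ℝ) : ℂ) * z j k = z j k * (((s : ℝ) : ℂ) * 1)
    ring

variable {A : Type*} [NonUnitalCStarAlgebra A] {E : ι → ι → cone ℂ →ₗ[ℂ] A}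

/-- Linear maps `E j k : C ℂ → A` that multiply like the maps `f ↦ f ⊗ e_{j,k}` into the cone over
the matrix algebra. -/
structure IsConeMatrixUnits (E : ι → ι → cone ℂ →ₗ[ℂ] A) : Prop where
  mul_same : ∀ j k m f g, E j k f * E k m g = E j m (f * g)
  mul_of_ne : ∀ j {k l} m, k ≠ l → ∀ f g, E j k f * E l m g = 0
  star_apply : ∀ j k f, star (E j k f) = E k j (star f)

lemma IsConeMatrixUnits.mul_sum_sum (hE : IsConeMatrixUnits E) (j k : ι) (f : cone ℂ)
    (g : ι → ι → cone ℂ) :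
    E j k f * ∑ l, ∑ m, E l m (g l m) = ∑ m, E j m (f * g k m) := by
  simp only [Finset.mul_sum]
  refine (Finset.sum_eq_single k (fun l _ hl => ?_) (by simp)).trans ?_
  · exact Finset.sum_eq_zero fun m _ => hE.mul_of_ne j m hl.symm _ _
  · simp only [hE.mul_same]

/-- The *-homomorphism of the cone over the matrix algebra that sends `f ⊗ e_{j,k}` to
`E j k f`. -/
noncomputable def IsConeMatrixUnits.coneHom (hE : IsConeMatrixUnits E) :
    cone (CStarMatrix ι ι ℂ) →⋆ₙₐ[ℂ] A where
  toFun F := ∑ j, ∑ k, E j k (coneEntry j k F)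
  map_smul' c F := by simp only [map_smul, Finset.smul_sum, MonoidHom.id_apply]
  map_zero' := by simp only [map_zero, Finset.sum_const_zero]
  map_add' F G := by simp only [map_add, Finset.sum_add_distrib]
  map_mul' F G := by
    simp only [coneEntry_mul, map_sum, Finset.sum_mul, hE.mul_sum_sum]
    exact Finset.sum_congr rfl fun j _ => Finset.sum_comm
  map_star' F := by
    simp only [coneEntry_star, star_sum, hE.star_apply]
    exact Finset.sum_comm

lemma IsConeMatrixUnits.coneHom_coneTensor (hE : IsConeMatrixUnits E) (z : CStarMatrix ι ι ℂ) :
    hE.coneHom (coneTensor z) = ∑ j, ∑ k, z j k • E j k (coneTensor 1) := by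
  change ∑ j, ∑ k, E j k (coneEntry j k (coneTensor z)) = _
  simp only [coneEntry_coneTensor, map_smul]

end Entry

namespace ConeRelations
variable {A : Type*} [NonUnitalCStarAlgebra A] [PartialOrder A] [StarOrderedRing A] {n : ℕ}

lemma exists_isConeMatrixUnits {x : Fin n → Fin n → A} (hx : ConeRelations x)
    (h0 : ∀ j, 0 ≤ x j j) :
    ∃ E : Fin n → Fin n → cone ℂ →ₗ[ℂ] A,
      IsConeMatrixUnits E ∧ ∀ j k, E j k (coneTensor 1) = x j k := by
  have hinj := Unitization.inr_injective (R := ℂ) (A := A)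
  have hX : ConeRelations fun j k => (x j k : A⁺¹) :=
    (map_iff (Unitization.inrNonUnitalStarAlgHom ℂ A) hinj).mpr hx
  have hsum : ((∑ l, x l l : A) : A⁺¹) = ∑ l, (x l l : A⁺¹) :=
    map_sum (Unitization.inrNonUnitalStarAlgHom ℂ A) _ _
  obtain ⟨Φ, hΦ, hcomm⟩ := exists_intervalCalculus
    (Unitization.inr_nonneg_iff.mpr (Finset.sum_nonneg fun l _ => h0 l))
    ((Unitization.norm_inr (𝕜 := ℂ) _).trans_le hx.norm_sum_le)
  have hΦx (f : C(unitInterval, ℂ)) (j k : Fin n) : Commute (Φ f) (x j k) :=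
    hcomm _ (hsum ▸ hX.commute_sum j k) f
  choose Ψ hΨ using fun j k => exists_coneMap_of_mul_star_le Φ hΦ (hx.mul_star_le j k)
  refine ⟨fun j k => Ψ j k, ⟨fun j k m f g => ?_, fun j k l m hkl f g => ?_, fun j k f => ?_⟩,
    fun j k => hinj ?_⟩
  · refine denseRange_coordMul.induction_on₂ (p := fun f g => Ψ j k f * Ψ k m g = Ψ j m (f * g))
      (isClosed_eq (by fun_prop) (by fun_prop)) (fun f g => hinj ?_) f g
    rw [Unitization.inr_mul, coordMul_mul_coordMul, hΨ, hΨ, hΨ,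
      hX.mul_mul_mul_same _ _ (hΦx g j k), mul_right_comm f, map_mul, map_mul, hΦ, hsum]
  · refine denseRange_coordMul.induction_on₂ (p := fun f g => Ψ j k f * Ψ l m g = 0)
      (isClosed_eq (by fun_prop) (by fun_prop)) (fun f g => hinj ?_) f g
    rw [Unitization.inr_mul, hΨ, hΨ, hX.mul_mul_mul_of_ne _ _ hkl (hΦx g j k),
      Unitization.inr_zero]
  · refine denseRange_coordMul.induction_on (p := fun f => star (Ψ j k f) = Ψ k j (star f)) f
      (isClosed_eq (by fun_prop) (by fun_prop)) fun f => hinj ?_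
    rw [Unitization.inr_star, star_coordMul, hΨ, hΨ, star_mul, hX.star_eq,
      ← map_star, (hΦx (star f) k j).eq]
  · change (Ψ j k (coneTensor 1) : A⁺¹) = x j k
    rw [← coordMul_one, hΨ, map_one, one_mul]

lemma exists_coneHom {φ : MatAlg n →ₗ[ℂ] A} (hφ : ConeRelations fun j k => φ (matUnit j k))
    (h0 : ∀ j, 0 ≤ φ (matUnit j j)) :
    ∃ π : cone (MatAlg n) →⋆ₙₐ[ℂ] A, ∀ z, φ z = π (coneTensor z) := by
  obtain ⟨E, hE, hE1⟩ := hφ.exists_isConeMatrixUnits h0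
  refine ⟨hE.coneHom, fun z => ?_⟩
  rw [hE.coneHom_coneTensor]
  conv_lhs => rw [matAlg_eq_sum_smul_matUnit z]
  simp only [map_sum, map_smul, hE1]

end ConeRelations

theorem corollary1p5 {A : Type*} [NonUnitalCStarAlgebra A] [PartialOrder A] [StarOrderedRing A]
    (n : ℕ) (hn : 0 < n) (φ : MatAlg n →ₗ[ℂ] A) :
    List.TFAE [
      IsCP φ ∧ (∀ z : MatAlg n, ‖φ z‖ ≤ ‖z‖) ∧ IsOrderZero φ,
      ∃ π : cone (MatAlg n) →⋆ₙₐ[ℂ] A, ∀ z : MatAlg n, φ z = π (coneTensor z),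
      ConeRelations (fun j k => (φ (matUnit j k) : Unitization ℂ A)) ∧
        ∀ j, ‖1 - (φ (matUnit j j) : Unitization ℂ A)‖ ≤ 1,
      ConeRelations (fun j k => φ (matUnit j k)) ∧ ∀ j, 0 ≤ φ (matUnit j j)] := by
  tfae_have 1 → 4 := fun ⟨hcp, hcontr, hzero⟩ =>
    ⟨hzero.coneRelations hcp hcontr,
      fun j => hcp.map_nonneg (isStarProjection_matUnit_self j).nonneg⟩
  tfae_have 4 → 2 := fun ⟨hrel, hpos⟩ => hrel.exists_coneHom hpos
  tfae_have 2 → 1 := fun ⟨_, hπ⟩ =>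
    ⟨isCP_of_coneHom hπ, norm_le_of_coneHom hπ, isOrderZero_of_coneHom hπ⟩
  tfae_have 3 ↔ 4 := by
    rw [← ConeRelations.map_iff (Unitization.inrNonUnitalStarAlgHom ℂ A)
      Unitization.inr_injective]
    refine and_congr_right fun hrel => forall_congr' fun j => ?_
    exact (norm_one_sub_le_one_iff_nonneg (hrel.star_eq j j) (hrel.norm_le j)).trans
      Unitization.inr_nonneg_iff
  tfae_finish
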